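/- All topological spaces and topological groups are assumed to be Hausdorff. A topological group $G$ is called $\omega$-narrow if for every neighborhood $U$ of the identity there is a countable set $C\subseteq G$ with $G=CU$. The following conditions are equivalent for an arbitrary $\omega$-narrow topological group $G$: (a) $G$ is homeomorphic to a subspace of a separable regular space; (b) $G$ is topologically isomorphic to a subgroup of a separable topological group; (c) $G$ is topologically isomorphic to a closed subgroup of a separable path-connected, locally path-connected topological group. -/

import Mathlib

universe u

/-- A topological group is `ω`-narrow if for every neighbourhood `U` of the identity it is covered
by countably many (left) translates of `U`. -/
def IsOmegaNarrow (G : Type*) [Group G] [TopologicalSpace G] : Prop :=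
  ∀ U ∈ nhds (1 : G), ∃ C : Set G, C.Countable ∧ ⋃ g ∈ C, (fun x => g * x) '' U = Set.univ

open Filter Topology Pointwise TopologicalSpace Set MeasureTheory ENNReal

/-! (a) ⇒ (b): in a separable regular space, closures of subsets of a countable dense set give each
point a local base indexed by sets of naturals. For each basic neighbourhood of the identity,
`IsOmegaNarrow.exists_hom_separable` gives a homomorphism into a separable group that detects it.
The diagonal map into the product is an embedding, and a product of at most continuum many separable
groups is separable.

(b) ⇒ (c) is a Hartman–Mycielski construction: step functions on [0, 1) with values in the separable
group, under convergence in measure, contain the subgroup `A` as constants. Truncation gives paths.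
Requiring values in `A` near 1 makes the constants closed even when `A` is not closed.

(c) ⇒ (a): Hausdorff topological groups are regular. -/

/-- The restriction of an injective inducing homomorphism to its range is an isomorphism of
topological groups. -/
theorem nonempty_continuousMulEquiv_range {G H : Type*} [Group G] [TopologicalSpace G] [Group H]
    [TopologicalSpace H] (φ : G →* H) (hφ : IsEmbedding φ) : Nonempty (G ≃ₜ* φ.range) :=
  ⟨{ MonoidHom.ofInjective hφ.injective with
      continuous_toFun := hφ.continuous.subtype_mk _
      continuous_invFun := by
        rw [hφ.continuous_iff]
        convert continuous_subtype_val using 1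
        funext x
        exact MonoidHom.apply_ofInjective_symm hφ.injective x }⟩

/-! ### Products of separable spaces -/

/-- **Hewitt–Marczewski–Pondiczery**: a product of at most continuum many separable spaces is
separable. -/
theorem separableSpace_pi_of_injective {ι : Type*} {X : ι → Type*} [∀ i, TopologicalSpace (X i)]
    [∀ i, SeparableSpace (X i)] (A : ι → Set ℕ) (hA : Function.Injective A) :
    SeparableSpace (∀ i, X i) := by
  classical
  obtain he | ⟨⟨x₀⟩⟩ := isEmpty_or_nonempty (∀ i, X i)
  · infer_instance
  have hne (i) : Nonempty (X i) := ⟨x₀ i⟩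
  -- Finitely many distinct sets `A i` have distinct traces below a large `n`, so a finitely
  -- supported function of the trace can prescribe finitely many coordinates independently.
  let trace : ℕ → ι → Finset ℕ := fun n i => (Finset.range n).filter (· ∈ A i)
  let p : ℕ × (Finset ℕ →₀ ℕ) → ∀ i, X i := fun q i => denseSeq (X i) (q.2 (trace q.1 i))
  refine ⟨range p, countable_range p, ?_⟩
  rw [dense_iff_inter_open]
  rintro W hW ⟨x, hx⟩
  obtain ⟨F, u, hu, hFu⟩ := isOpen_pi_iff.1 hW x hx
  have hm (i : ι) : ∃ m, i ∈ F → denseSeq (X i) m ∈ u i := by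
    by_cases hi : i ∈ F
    · obtain ⟨_, h, m, rfl⟩ :=
        (denseRange_denseSeq (X i)).inter_open_nonempty (u i) (hu i hi).1 ⟨_, (hu i hi).2⟩
      exact ⟨m, fun _ => h⟩
    · exact ⟨0, fun h => absurd h hi⟩
  choose m hm using hm
  have hsep (i j : ι) : ∃ n, i ≠ j → ∀ k, n ≤ k → trace k i ≠ trace k j := by
    by_cases hij : i = j
    · exact ⟨0, fun h => absurd hij h⟩
    · have : ∃ n, ¬ (n ∈ A i ↔ n ∈ A j) := by
        by_contra! h
        exact hij (hA (Set.ext h))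
      obtain ⟨n, hn⟩ := this
      refine ⟨n + 1, fun _ k hk h => hn ?_⟩
      have := congrArg (n ∈ ·) h
      simp only [trace, Finset.mem_filter, Finset.mem_range, eq_iff_iff] at this
      have hnk : n < k := hk
      simpa [hnk] using this
  choose N hN using hsep
  let n := (F ×ˢ F).sup fun q => N q.1 q.2
  have hinj (i) (hi : i ∈ F) (j) (hj : j ∈ F) (h : trace n i = trace n j) : i = j := by
    by_contra hij
    exact hN i j hij n
      (Finset.le_sup (f := fun q : ι × ι => N q.1 q.2) (Finset.mk_mem_product hi hj)) h
  have hφ : ∃ φ : Finset ℕ →₀ ℕ, ∀ i ∈ F, φ (trace n i) = m i := by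
    refine ⟨Finsupp.onFinset (F.image (trace n))
      (fun s => if h : ∃ i ∈ F, trace n i = s then m h.choose else 0) ?_, ?_⟩
    · intro s hs
      by_contra h
      refine hs (dif_neg ?_)
      rintro ⟨i, hi, rfl⟩
      exact h (Finset.mem_image_of_mem _ hi)
    · intro i hi
      have h : ∃ j ∈ F, trace n j = trace n i := ⟨i, hi, rfl⟩
      simp only [Finsupp.onFinset_apply, dif_pos h]
      rw [hinj _ h.choose_spec.1 i hi h.choose_spec.2]
  obtain ⟨φ, hφ⟩ := hφ
  refine ⟨p (n, φ), hFu fun i hi => ?_, mem_range_self _⟩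
  simp only [p, hφ i hi]
  exact hm i hi

/-! ### Homomorphisms of ω-narrow groups into separable groups -/

/-- Every neighbourhood of `1` in an `ω`-narrow group admits a countable family of neighbourhoods
of `1` witnessing the axioms of a group topology for it. -/
theorem IsOmegaNarrow.exists_seq_nhds_one {G : Type*} [Group G] [TopologicalSpace G]
    [IsTopologicalGroup G] (hG : IsOmegaNarrow G) {V : Set G} (hV : V ∈ 𝓝 (1 : G)) :
    ∃ w : ℕ → Set G, (∀ n, w n ∈ 𝓝 (1 : G)) ∧ (∃ n, w n * w n ⊆ V) ∧ (∃ n, (w n)⁻¹ ⊆ V) ∧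
      ∀ x, ∃ n, ∀ y ∈ w n, x * y * x⁻¹ ∈ V := by
  obtain ⟨S, hS, hSV⟩ : ∃ S ∈ 𝓝 (1 : G), S * S ⊆ V := by
    obtain ⟨S, hSo, h1, hS⟩ := exists_open_nhds_one_mul_subset hV
    exact ⟨S, hSo.mem_nhds h1, hS⟩
  have hT : V⁻¹ ∈ 𝓝 (1 : G) := inv_mem_nhds_one G hV
  have hc : Tendsto (fun q : G × G => q.1⁻¹ * q.2 * q.1) (𝓝 1 ×ˢ 𝓝 1) (𝓝 1) := by
    have : Continuous fun q : G × G => q.1⁻¹ * q.2 * q.1 := by fun_prop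
    simpa [nhds_prod_eq] using this.tendsto (1, 1)
  obtain ⟨W, hW, hWV⟩ := (𝓝 (1 : G)).basis_sets.prod_self.mem_iff.1 (hc hV)
  obtain ⟨C, hC, hCW⟩ := hG W hW
  have hCne : C.Nonempty := by
    rw [nonempty_iff_ne_empty]
    rintro rfl
    have : (1 : G) ∈ (⋃ g ∈ (∅ : Set G), (fun x => g * x) '' W) := hCW ▸ mem_univ _
    simp at this
  obtain ⟨c, rfl⟩ := hC.exists_eq_range hCne
  -- Writing `x⁻¹ = c l * y` with `y ∈ W` gives `x * z * x⁻¹ = y⁻¹ * ((c l)⁻¹ * z * c l) * y`, so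
  -- countably many conjugates of `W` serve all `x`.
  refine ⟨fun n => n.casesOn S fun k => k.casesOn V⁻¹ fun l => (fun y => (c l)⁻¹ * y * c l) ⁻¹' W,
    ?_, ⟨0, hSV⟩, ⟨1, by simp⟩, fun x => ?_⟩
  · rintro (_ | _ | l)
    · exact hS
    · exact hT
    · have : Continuous fun y => (c l)⁻¹ * y * c l := by fun_prop
      refine this.continuousAt.preimage_mem_nhds ?_
      simpa using hW
  · have hx : x⁻¹ ∈ ⋃ g ∈ range c, (fun x => g * x) '' W := hCW ▸ mem_univ _
    simp only [mem_iUnion, mem_range, mem_image] at hx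
    obtain ⟨_, ⟨l, rfl⟩, y, hy, hxy⟩ := hx
    refine ⟨l + 2, fun z hz => ?_⟩
    have hz' : (c l)⁻¹ * z * c l ∈ W := hz
    have := hWV (mk_mem_prod hy hz')
    have hx' : x = y⁻¹ * (c l)⁻¹ := by rw [← inv_inv x, ← hxy, mul_inv_rev]
    simpa [hx', mul_assoc] using this

/-- **Guran**: an `ω`-narrow group has, for every neighbourhood `U` of `1`, a continuous
homomorphism into a separable Hausdorff group for which `U` contains the preimage of a neighbourhood
of `1`. -/
theorem IsOmegaNarrow.exists_hom_separable {G : Type u} [Group G] [t : TopologicalSpace G]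
    [IsTopologicalGroup G] (hG : IsOmegaNarrow G) {U : Set G} (hU : U ∈ 𝓝 (1 : G)) :
    ∃ (P : Type u) (_ : Group P) (_ : TopologicalSpace P),
      IsTopologicalGroup P ∧ T2Space P ∧ SeparableSpace P ∧
      ∃ φ : G →* P, Continuous φ ∧ U ∈ comap φ (𝓝 1) := by
  have hw (V : {V : Set G // V ∈ 𝓝 (1 : G)}) := hG.exists_seq_nhds_one V.2
  choose w hw hmul hinv hconj using hw
  -- Iterating `w` from `U` along finite lists yields a countable family, hence a coarser, countably
  -- generated group topology.
  let v : List ℕ → {V : Set G // V ∈ 𝓝 (1 : G)} :=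
    fun l => l.rec ⟨U, hU⟩ fun n _ V => ⟨w V n, hw V n⟩
  have hv (n : ℕ) (l : List ℕ) : (v (n :: l)).1 = w (v l) n := rfl
  let N : Filter G := ⨅ l, 𝓟 (v l).1
  have hN : 𝓝 1 ≤ N := le_iInf fun l => le_principal_iff.2 (v l).2
  have hvN (l) : (v l).1 ∈ N := mem_iInf_of_mem l (mem_principal_self _)
  have tmul : Tendsto (fun q : G × G => q.1 * q.2) (N ×ˢ N) N := by
    refine tendsto_iInf.2 fun l => tendsto_principal.2 ?_
    obtain ⟨n, hn⟩ := hmul (v l)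
    filter_upwards [prod_mem_prod (hvN (n :: l)) (hvN (n :: l))] with q hq
    exact hn (mul_mem_mul hq.1 hq.2)
  have tinv : Tendsto (fun x : G => x⁻¹) N N := by
    refine tendsto_iInf.2 fun l => tendsto_principal.2 ?_
    obtain ⟨n, hn⟩ := hinv (v l)
    filter_upwards [hvN (n :: l)] with q hq
    exact hn (inv_mem_inv.2 hq)
  have tconj (x : G) : Tendsto (fun y : G => x * y * x⁻¹) N N := by
    refine tendsto_iInf.2 fun l => tendsto_principal.2 ?_
    obtain ⟨n, hn⟩ := hconj (v l) x
    filter_upwards [hvN (n :: l)] with q hq using hn q hq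
  let B : GroupFilterBasis G :=
    { N.asBasis with
      one' := fun {V} hV => mem_of_mem_nhds (hN hV)
      mul' := fun {V} hV => by
        obtain ⟨W, hW, hWV⟩ := N.basis_sets.prod_self.mem_iff.1 (tmul hV)
        refine ⟨W, hW, ?_⟩
        rintro _ ⟨a, ha, b, hb, rfl⟩
        exact hWV (mk_mem_prod ha hb)
      inv' := fun {V} hV => ⟨_, tinv hV, subset_rfl⟩
      conj' := fun x {V} hV => ⟨_, tconj x hV, subset_rfl⟩ }
  have hB : @nhds G B.topology 1 = N := by
    rw [B.nhds_one_eq]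
    exact N.asBasis_filter
  have hcont : Continuous[t, B.topology] (id : G → G) := by
    rw [continuous_id_iff_le]
    refine le_of_nhds_le_nhds fun x => ?_
    rw [B.nhds_eq, GroupFilterBasis.N, ← map_mul_left_nhds_one x, ← B.nhds_one_eq, hB]
    exact map_mono hN
  have hsep : @SeparableSpace G B.topology := by
    have : N.IsCountablyGenerated := inferInstanceAs (⨅ l, 𝓟 (v l).1).IsCountablyGenerated
    obtain ⟨b, hb⟩ := N.exists_antitone_basis
    choose C hC hCb using fun n => hG (b n) (hN (hb.1.mem_of_mem trivial))
    let := B.topology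
    refine ⟨⋃ n, C n, countable_iUnion hC, fun x => ?_⟩
    rw [mem_closure_iff_nhds_basis (B.nhds_hasBasis x)]
    intro V hV
    obtain ⟨n, -, hn⟩ := hb.1.mem_iff.1 (tinv hV)
    have hx : x ∈ ⋃ g ∈ C n, (fun x => g * x) '' b n := hCb n ▸ mem_univ _
    simp only [mem_iUnion, mem_image] at hx
    obtain ⟨c, hc, y, hy, rfl⟩ := hx
    exact ⟨c, mem_iUnion.2 ⟨n, hc⟩, y⁻¹, hn hy, by simp⟩
  -- This topology need not be Hausdorff, hence the separation quotient.
  let t' : TopologicalSpace G := B.topology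
  have : IsTopologicalGroup G := B.isTopologicalGroup
  refine ⟨SeparationQuotient G, inferInstance, inferInstance, inferInstance, inferInstance,
    SeparationQuotient.surjective_mk.denseRange.separableSpace SeparationQuotient.continuous_mk,
    SeparationQuotient.mkMonoidHom, ?_, ?_⟩
  · exact @Continuous.comp G G _ t t' _ _ _ SeparationQuotient.continuous_mk hcont
  · have h : comap (SeparationQuotient.mk : G → _) (𝓝 1) = 𝓝 1 :=
      SeparationQuotient.comap_mk_nhds_mk
    change U ∈ comap (SeparationQuotient.mk : G → _) (𝓝 1)
    rw [h]
    exact hB ▸ hvN []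

/-! ### Embedding into a separable group -/

/-- Every point of a subspace of a separable regular space has a neighbourhood basis indexed by
sets of natural numbers. -/
theorem exists_nhds_subset_of_separable_regular {Y X : Type*} [TopologicalSpace Y]
    [TopologicalSpace X] [RegularSpace X] [SeparableSpace X] {f : Y → X} (hf : IsInducing f)
    (y : Y) : ∃ N : Set ℕ → Set Y, ∀ U ∈ 𝓝 y, ∃ A, N A ∈ 𝓝 y ∧ N A ⊆ U := by
  have : Nonempty X := ⟨f y⟩
  refine ⟨fun A => f ⁻¹' closure (denseSeq X '' A), fun U hU => ?_⟩
  rw [hf.nhds_eq_comap] at hU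
  obtain ⟨S, hS, hSU⟩ := hU
  obtain ⟨T, ⟨hT, hTc⟩, hTS⟩ := (closed_nhds_basis (f y)).mem_iff.1 hS
  refine ⟨denseSeq X ⁻¹' interior T, ?_, ?_⟩
  · refine hf.continuous.continuousAt.preimage_mem_nhds ?_
    refine mem_of_superset (interior_mem_nhds.2 hT) ?_
    rw [image_preimage_eq_inter_range]
    exact (denseRange_denseSeq X).open_subset_closure_inter isOpen_interior
  · refine (preimage_mono ?_).trans hSU
    refine (closure_minimal ?_ hTc).trans hTS
    exact (image_preimage_subset _ _).trans interior_subset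

/-- An `ω`-narrow Hausdorff group which embeds into a separable regular space embeds
into a separable Hausdorff group. -/
theorem IsOmegaNarrow.exists_embedding_separable {G : Type u} [Group G] [TopologicalSpace G]
    [IsTopologicalGroup G] [T2Space G] (hG : IsOmegaNarrow G) {X : Type*} [TopologicalSpace X]
    [RegularSpace X] [SeparableSpace X] {f : G → X} (hf : IsInducing f) :
    ∃ (H : Type u) (_ : Group H) (_ : TopologicalSpace H),
      IsTopologicalGroup H ∧ T2Space H ∧ SeparableSpace H ∧ ∃ φ : G →* H, IsEmbedding φ := by
  obtain ⟨N, hN⟩ := exists_nhds_subset_of_separable_regular hf (1 : G)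
  let I := {A : Set ℕ // N A ∈ 𝓝 (1 : G)}
  choose P iG iT hP hT2 hsep φ hφ hφN using fun A : I => hG.exists_hom_separable A.2
  have : SeparableSpace (∀ A, P A) :=
    separableSpace_pi_of_injective (fun A : I => A.1) Subtype.val_injective
  let Φ : G →* ∀ A, P A := MonoidHom.pi φ
  have hΦ : Continuous Φ := continuous_pi hφ
  refine ⟨∀ A, P A, inferInstance, inferInstance, inferInstance, inferInstance, inferInstance, Φ,
    ((IsTopologicalGroup.isInducing_iff_nhds_one (f := Φ)).2 (le_antisymm ?_ ?_)).isEmbedding⟩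
  · rw [← map_le_iff_le_comap]
    have h := hΦ.tendsto 1
    rwa [map_one] at h
  · intro U hU
    obtain ⟨A, hA, hAU⟩ := hN U hU
    obtain ⟨V, hV, hVN⟩ := hφN ⟨A, hA⟩
    refine ⟨(fun p => p ⟨A, hA⟩) ⁻¹' V, ?_, fun x hx => hAU (hVN hx)⟩
    exact (continuous_apply _).continuousAt.preimage_mem_nhds hV

/-! ### Step functions and convergence in measure -/

section Step

variable {H : Type u} [Group H]

/-- The function `ℝ → H` with value `h` on `[0, s)` and `1` elsewhere. -/
noncomputable def stepFun (s : ℝ) (h : H) : ℝ → H :=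
  fun t => if 0 ≤ t ∧ t < s then h else 1

theorem stepFun_mul (s : ℝ) (h k : H) : stepFun s (h * k) = stepFun s h * stepFun s k := by
  funext t
  by_cases ht : 0 ≤ t ∧ t < s <;> simp [stepFun, ht]

/-- The group of `H`-valued step functions on `[0, 1)`, extended by `1` to `ℝ`, with values
in the subgroup `A` near `1`. -/
def stepSubgroup (A : Subgroup H) : Subgroup (ℝ → H) :=
  Subgroup.closure {f | ∃ s h, s ≤ 1 ∧ (s < 1 ∨ h ∈ A) ∧ stepFun s h = f}

variable {A : Subgroup H}

theorem stepFun_mem {s : ℝ} {h : H} (hs : s ≤ 1) (hA : s < 1 ∨ h ∈ A) :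
    stepFun s h ∈ stepSubgroup A :=
  Subgroup.subset_closure ⟨s, h, hs, hA, rfl⟩

/-- Needed for the conjugation axiom: only finitely many conjugates of a neighbourhood have to be
intersected. -/
theorem finite_range_of_mem_stepSubgroup {f : ℝ → H} (hf : f ∈ stepSubgroup A) :
    (range f).Finite := by
  induction hf using Subgroup.closure_induction with
  | mem f hf =>
    obtain ⟨s, h, -, -, rfl⟩ := hf
    refine (toFinite {h, 1}).subset ?_
    rintro _ ⟨t, rfl⟩
    by_cases ht : 0 ≤ t ∧ t < s <;> simp [stepFun, ht]
  | one => exact (finite_singleton (1 : H)).subset (by rintro _ ⟨t, rfl⟩; simp)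
  | mul f g _ _ hf hg =>
    refine (hf.mul hg).subset ?_
    rintro _ ⟨t, rfl⟩
    exact mul_mem_mul (mem_range_self t) (mem_range_self t)
  | inv f _ hf =>
    refine hf.inv.subset ?_
    rintro _ ⟨t, rfl⟩
    exact inv_mem_inv.2 (mem_range_self t)

theorem eq_one_of_mem_stepSubgroup {f : ℝ → H} (hf : f ∈ stepSubgroup A) {t : ℝ}
    (ht : ¬ (0 ≤ t ∧ t < 1)) : f t = 1 := by
  induction hf using Subgroup.closure_induction with
  | mem f hf =>
    obtain ⟨s, h, hs, -, rfl⟩ := hf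
    exact if_neg fun h' => ht ⟨h'.1, h'.2.trans_le hs⟩
  | one => rfl
  | mul f g _ _ hf hg => simp [hf, hg]
  | inv f _ hf => simp [hf]

/-- Half-open steps make a value at one point persist on an interval of positive length, so
convergence in measure sees it. -/
theorem eventually_eq_of_mem_stepSubgroup {f : ℝ → H} (hf : f ∈ stepSubgroup A) (t : ℝ) :
    ∀ᶠ x in 𝓝[≥] t, f x = f t := by
  induction hf using Subgroup.closure_induction with
  | mem f hf =>
    obtain ⟨s, h, -, -, rfl⟩ := hf
    rcases lt_or_ge t 0 with h0 | h0
    · filter_upwards [mem_nhdsWithin_of_mem_nhds (Iio_mem_nhds h0)] with x hx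
      simp [stepFun, not_le.2 h0, not_le.2 (mem_Iio.1 hx)]
    · rcases lt_or_ge t s with hs | hs
      · filter_upwards [mem_nhdsWithin_of_mem_nhds (Iio_mem_nhds hs), self_mem_nhdsWithin]
          with x hx hx'
        simp [stepFun, h0, hs, h0.trans hx', mem_Iio.1 hx]
      · filter_upwards [self_mem_nhdsWithin] with x hx
        simp [stepFun, not_lt.2 hs, not_lt.2 (hs.trans hx)]
  | one => simp
  | mul f g _ _ hf hg =>
    filter_upwards [hf, hg] with x h1 h2
    simp [h1, h2]
  | inv f _ hf =>
    filter_upwards [hf] with x h1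
    simp [h1]

theorem eventually_mem_of_mem_stepSubgroup {f : ℝ → H} (hf : f ∈ stepSubgroup A) :
    ∀ᶠ x in 𝓝[<] (1 : ℝ), f x ∈ A := by
  induction hf using Subgroup.closure_induction with
  | mem f hf =>
    obtain ⟨s, h, -, hs | hA, rfl⟩ := hf
    · filter_upwards [mem_nhdsWithin_of_mem_nhds (Ioi_mem_nhds hs)] with x hx
      simp [stepFun, not_lt.2 (mem_Ioi.1 hx).le]
    · refine Eventually.of_forall fun x => ?_
      by_cases hx : 0 ≤ x ∧ x < s <;> simp [stepFun, hx, hA]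
  | one => simp
  | mul f g _ _ hf hg =>
    filter_upwards [hf, hg] with x h1 h2 using A.mul_mem h1 h2
  | inv f _ hf =>
    filter_upwards [hf] with x h1 using A.inv_mem h1

theorem cut_mem_stepSubgroup {f : ℝ → H} (hf : f ∈ stepSubgroup A) (s : ℝ) :
    (fun t => if t < s then f t else 1) ∈ stepSubgroup A := by
  induction hf using Subgroup.closure_induction with
  | mem f hf =>
    obtain ⟨r, h, hr, hA, rfl⟩ := hf
    have : (fun t => if t < s then stepFun r h t else 1) = stepFun (min r s) h := by
      funext t
      by_cases h1 : t < s <;> by_cases h2 : t < r <;> simp [stepFun, h1, h2]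
    rw [this]
    exact stepFun_mem ((min_le_left _ _).trans hr) (hA.imp (min_le_left _ _).trans_lt id)
  | one =>
    convert (stepSubgroup A).one_mem using 1
    funext t
    simp
  | mul f g _ _ hf hg =>
    convert (stepSubgroup A).mul_mem hf hg using 1
    funext t
    by_cases h1 : t < s <;> simp [h1]
  | inv f _ hf =>
    convert (stepSubgroup A).inv_mem hf using 1
    funext t
    by_cases h1 : t < s <;> simp [h1]

/-- The step functions of `stepSubgroup A` as a type, to be given the topology of convergence in
measure rather than that of pointwise convergence. -/
def StepGroup (A : Subgroup H) : Type u := stepSubgroup A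

namespace StepGroup

instance : Group (StepGroup A) := inferInstanceAs (Group (stepSubgroup A))

instance : CoeFun (StepGroup A) fun _ => ℝ → H := ⟨fun f => f.1⟩

@[simp] theorem one_apply (t : ℝ) : (1 : StepGroup A) t = 1 := rfl

@[simp] theorem mul_apply (f g : StepGroup A) (t : ℝ) : (f * g) t = f t * g t := rfl

@[simp] theorem inv_apply (f : StepGroup A) (t : ℝ) : f⁻¹ t = (f t)⁻¹ := rfl

theorem ext {f g : StepGroup A} (h : ∀ t, f t = g t) : f = g := Subtype.ext (funext h)

/-- The functions with values in `V` outside a set of measure less than `ε`. -/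
def nbhd (A : Subgroup H) (V : Set H) (ε : ℝ≥0∞) : Set (StepGroup A) :=
  {f | volume {t | f t ∉ V} < ε}

theorem mem_nbhd_of_subset {V : Set H} {ε : ℝ≥0∞} {f : StepGroup A} {s : Set ℝ}
    (hs : ∀ t ∉ s, f t ∈ V) (h : volume s < ε) : f ∈ nbhd A V ε :=
  (measure_mono fun t ht => by_contra fun h' => (show f t ∉ V from ht) (hs t h')).trans_lt h

theorem nbhd_mono {V : Set H} {ε δ : ℝ≥0∞} (h : ε ≤ δ) : nbhd A V ε ⊆ nbhd A V δ :=
  fun _ hf => lt_of_lt_of_le hf h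

theorem one_mem_nbhd {V : Set H} (hV : 1 ∈ V) {ε : ℝ≥0∞} (hε : 0 < ε) :
    (1 : StepGroup A) ∈ nbhd A V ε :=
  mem_nbhd_of_subset (s := ∅) (fun _ _ => hV) (by simpa)

/-- Restriction of a step function to `(-∞, s)`. -/
noncomputable def cut (s : ℝ) (f : StepGroup A) : StepGroup A := ⟨_, cut_mem_stepSubgroup f.2 s⟩

theorem cut_apply (s : ℝ) (f : StepGroup A) (t : ℝ) : cut s f t = if t < s then f t else 1 := rfl

theorem cut_zero (f : StepGroup A) : cut 0 f = 1 := ext fun t => by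
  rw [cut_apply]
  split_ifs with h
  · exact eq_one_of_mem_stepSubgroup f.2 fun h' => not_lt.2 h'.1 h
  · rfl

theorem cut_one (f : StepGroup A) : cut 1 f = f := ext fun t => by
  rw [cut_apply]
  split_ifs with h
  · rfl
  · exact (eq_one_of_mem_stepSubgroup f.2 fun h' => h h'.2).symm

theorem cut_mem_nbhd {V : Set H} (hV : 1 ∈ V) {ε : ℝ≥0∞} {f : StepGroup A} (hf : f ∈ nbhd A V ε)
    (s : ℝ) : cut s f ∈ nbhd A V ε := by
  refine mem_nbhd_of_subset (fun t ht => ?_) hf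
  rw [cut_apply]
  split_ifs
  · exact not_not.1 ht
  · exact hV

theorem exists_mem_Ico_of_mem_nbhd {V : Set H} {g : StepGroup A} {a b : ℝ}
    (h : g ∈ nbhd A V (ENNReal.ofReal (b - a))) : ∃ t ∈ Ico a b, g t ∈ V := by
  by_contra! h'
  refine not_le.2 (show volume {t | g t ∉ V} < _ from h) ?_
  rw [← Real.volume_Ico]
  exact measure_mono h'

/-- The embedding of `A` as the group of functions constant on `[0, 1)`. -/
noncomputable def const (A : Subgroup H) : A →* StepGroup A :=
  MonoidHom.mk' (fun a => ⟨stepFun 1 (a : H), stepFun_mem le_rfl (Or.inr a.2)⟩)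
    fun a b => Subtype.ext (stepFun_mul 1 (a : H) b)

theorem const_apply (a : A) (t : ℝ) : const A a t = if 0 ≤ t ∧ t < 1 then (a : H) else 1 := rfl

theorem const_apply_of_mem (a : A) {t : ℝ} (ht : t ∈ Ico (0 : ℝ) 1) : const A a t = a := if_pos ht

variable [TopologicalSpace H] [IsTopologicalGroup H]

/-- The filter basis of the topology of convergence in measure. -/
@[reducible]
def basis (A : Subgroup H) : GroupFilterBasis (StepGroup A) where
  sets := {S | ∃ V ∈ 𝓝 (1 : H), ∃ ε > 0, nbhd A V ε = S}
  nonempty := ⟨_, univ, univ_mem, 1, one_pos, rfl⟩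
  inter_sets := by
    rintro _ _ ⟨V, hV, ε, hε, rfl⟩ ⟨W, hW, δ, hδ, rfl⟩
    refine ⟨_, ⟨V ∩ W, inter_mem hV hW, min ε δ, lt_min hε hδ, rfl⟩, fun f hf => ⟨?_, ?_⟩⟩
    · exact mem_nbhd_of_subset (fun t ht => (not_not.1 ht).1) (lt_of_lt_of_le hf (min_le_left _ _))
    · exact mem_nbhd_of_subset (fun t ht => (not_not.1 ht).2) (lt_of_lt_of_le hf (min_le_right _ _))
  one' := by
    rintro _ ⟨V, hV, ε, hε, rfl⟩
    exact one_mem_nbhd (mem_of_mem_nhds hV) hε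
  mul' := by
    rintro _ ⟨V, hV, ε, hε, rfl⟩
    obtain ⟨S, hSo, h1, hS⟩ := exists_open_nhds_one_mul_subset hV
    refine ⟨_, ⟨S, hSo.mem_nhds h1, ε / 2, ENNReal.half_pos hε.ne', rfl⟩, ?_⟩
    rintro _ ⟨f, hf, g, hg, rfl⟩
    refine mem_nbhd_of_subset (s := {t | f t ∉ S} ∪ {t | g t ∉ S}) (fun t ht => ?_) ?_
    · simp only [mem_union, mem_ofPred_eq, not_or, not_not] at ht
      exact hS (mul_mem_mul ht.1 ht.2)
    · calc _ ≤ _ := measure_union_le _ _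
        _ < ε / 2 + ε / 2 := ENNReal.add_lt_add hf hg
        _ = ε := ENNReal.add_halves ε
  inv' := by
    rintro _ ⟨V, hV, ε, hε, rfl⟩
    refine ⟨_, ⟨V⁻¹, inv_mem_nhds_one H hV, ε, hε, rfl⟩, fun f hf => ?_⟩
    exact mem_nbhd_of_subset (fun t ht => not_not.1 ht) hf
  conj' := by
    rintro f _ ⟨V, hV, ε, hε, rfl⟩
    refine ⟨_, ⟨⋂ h ∈ range f.1, (fun x => h * x * h⁻¹) ⁻¹' V, ?_, ε, hε, rfl⟩, fun g hg => ?_⟩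
    · refine (biInter_mem (finite_range_of_mem_stepSubgroup f.2)).2 fun h _ => ?_
      have : Continuous fun x => h * x * h⁻¹ := by fun_prop
      exact this.continuousAt.preimage_mem_nhds (by simpa using hV)
    · exact mem_nbhd_of_subset
        (fun t ht => mem_iInter₂.1 (not_not.1 ht) (f t) (mem_range_self t)) hg

instance : TopologicalSpace (StepGroup A) := (basis A).topology

instance : IsTopologicalGroup (StepGroup A) := (basis A).isTopologicalGroup

theorem nhds_one_hasBasis : (𝓝 (1 : StepGroup A)).HasBasis
    (fun p : Set H × ℝ≥0∞ => p.1 ∈ 𝓝 1 ∧ 0 < p.2) fun p => nbhd A p.1 p.2 := by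
  refine ⟨fun S => (basis A).nhds_one_hasBasis.mem_iff.trans ⟨?_, ?_⟩⟩
  · rintro ⟨_, ⟨V, hV, ε, hε, rfl⟩, h⟩
    exact ⟨(V, ε), ⟨hV, hε⟩, h⟩
  · rintro ⟨⟨V, ε⟩, ⟨hV, hε⟩, h⟩
    exact ⟨_, ⟨V, hV, ε, hε, rfl⟩, h⟩

theorem nhds_hasBasis (f : StepGroup A) : (𝓝 f).HasBasis
    (fun p : Set H × ℝ≥0∞ => p.1 ∈ 𝓝 1 ∧ 0 < p.2) fun p => {g | f⁻¹ * g ∈ nbhd A p.1 p.2} := by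
  have h : 𝓝 f = comap (fun g => f⁻¹ * g) (𝓝 1) := by
    have := (Homeomorph.mulLeft f⁻¹).isInducing.nhds_eq_comap f
    simpa using this
  rw [h]
  exact nhds_one_hasBasis.comap _

instance [T2Space H] : T2Space (StepGroup A) := by
  refine IsTopologicalGroup.t2Space_of_one_sep fun f hf => ?_
  obtain ⟨t, ht⟩ : ∃ t, f t ≠ 1 := by
    by_contra! h
    exact hf (ext h)
  obtain ⟨b, hb, hfb⟩ := mem_nhdsGE_iff_exists_Ico_subset.1
    (eventually_eq_of_mem_stepSubgroup f.2 t)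
  refine ⟨nbhd A {f t}ᶜ (ENNReal.ofReal (b - t)), nhds_one_hasBasis.mem_of_mem
    (i := ({f t}ᶜ, ENNReal.ofReal (b - t)))
    ⟨isOpen_compl_singleton.mem_nhds ht.symm, by simpa using hb⟩, fun h => ?_⟩
  obtain ⟨x, hx, hfx⟩ := exists_mem_Ico_of_mem_nbhd h
  exact hfx (hfb hx)

theorem continuous_cut (f : StepGroup A) : Continuous fun s => cut s f := by
  rw [continuous_iff_continuousAt]
  intro s
  refine (nhds_hasBasis _).tendsto_right_iff.2 ?_
  rintro ⟨V, ε⟩ ⟨hV, hε⟩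
  have h : Tendsto (fun r : ℝ => ENNReal.ofReal (max s r - min s r)) (𝓝 s) (𝓝 0) := by
    have : Continuous fun r : ℝ => ENNReal.ofReal (max s r - min s r) :=
      ENNReal.continuous_ofReal.comp (by fun_prop)
    simpa using this.tendsto s
  filter_upwards [h.eventually (gt_mem_nhds hε)] with r hr
  refine mem_nbhd_of_subset (s := Ico (min s r) (max s r)) (fun t ht => ?_) (by simpa using hr)
  have : t < s ↔ t < r := by
    simp only [mem_Ico, not_and, not_lt, min_le_iff, max_le_iff] at ht
    constructor <;> intro h <;> by_contra! h'
    · exact absurd (ht (Or.inr h')).1 (not_le.2 h)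
    · exact absurd (ht (Or.inl h')).2 (not_le.2 h)
  -- The two truncations differ only between `s` and `r`.
  have h1 : (cut s f)⁻¹ * cut r f ∈ {g : StepGroup A | g t = 1} := by
    by_cases h : t < r <;> simp [cut_apply, this, h]
  rw [show ((cut s f)⁻¹ * cut r f) t = 1 from h1]
  exact mem_of_mem_nhds hV

/-- The path `s ↦ f * cut s (f⁻¹ * g)` runs from `f` to `g`; it stays inside because truncation only
replaces values by `1`. -/
theorem isPathConnected_translate_nbhd (f : StepGroup A) {V : Set H} (hV : V ∈ 𝓝 1) {ε : ℝ≥0∞}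
    (hε : 0 < ε) : IsPathConnected {g | f⁻¹ * g ∈ nbhd A V ε} := by
  have h1 := mem_of_mem_nhds hV
  refine ⟨f, by simpa using one_mem_nbhd h1 hε, fun {g} hg => ?_⟩
  refine JoinedIn.ofLine (f := fun s => f * cut s (f⁻¹ * g))
    (continuous_const.mul (continuous_cut _)).continuousOn (by simp [cut_zero])
    (by simp [cut_one]) ?_
  rintro _ ⟨s, -, rfl⟩
  simpa using cut_mem_nbhd h1 hg s

instance : LocallyPathConnectedSpace (StepGroup A) :=
  .of_bases nhds_hasBasis fun f _ hp => isPathConnected_translate_nbhd f hp.1 hp.2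

instance : PathConnectedSpace (StepGroup A) := by
  rw [pathConnectedSpace_iff_univ]
  convert isPathConnected_translate_nbhd (1 : StepGroup A) (univ_mem (f := 𝓝 (1 : H))) one_pos
  symm
  refine eq_univ_of_forall fun g => ?_
  exact mem_nbhd_of_subset (s := ∅) (fun _ _ => mem_univ _) (by simp)

instance [SeparableSpace H] : SeparableSpace (StepGroup A) := by
  obtain ⟨D, hD, hDd⟩ := exists_countable_dense H
  have : Countable D := hD
  let gen : {q : ℚ // (q : ℝ) < 1} × D → StepGroup A :=
    fun p => ⟨stepFun p.1 p.2, stepFun_mem p.1.2.le (Or.inl p.1.2)⟩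
  let S := (FreeGroup.lift gen).range
  have hgen (p) : gen p ∈ S := ⟨FreeGroup.of p, by simp⟩
  refine ⟨S, countable_range (FreeGroup.lift gen), ?_⟩
  -- The closure of the countable subgroup `S` is a subgroup, so approximating generators suffices.
  suffices h : ∀ f (hf : f ∈ stepSubgroup A), (⟨f, hf⟩ : StepGroup A) ∈ S.topologicalClosure from
    fun f => h f.1 f.2
  intro f hf
  induction hf using Subgroup.closure_induction with
  | mem f hf =>
    obtain ⟨s, h, hs, hA, rfl⟩ := hf
    refine (mem_closure_iff_nhds_basis (nhds_hasBasis _)).2 ?_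
    rintro ⟨V, ε⟩ ⟨hV, hε⟩
    -- Strictness gives `q < 1` even if `s = 1`, so the value `d` need not lie in `A`.
    obtain ⟨q, hq, hqs⟩ : ∃ q : ℚ, (q : ℝ) < s ∧ ENNReal.ofReal (s - q) < ε := by
      have ht : Tendsto (fun r : ℝ => ENNReal.ofReal (s - r)) (𝓝 s) (𝓝 0) := by
        have : Continuous fun r : ℝ => ENNReal.ofReal (s - r) :=
          ENNReal.continuous_ofReal.comp (by fun_prop)
        simpa using this.tendsto s
      obtain ⟨l, hl, hls⟩ := mem_nhdsLE_iff_exists_Ioc_subset.1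
        (mem_nhdsWithin_of_mem_nhds (ht.eventually (gt_mem_nhds hε)))
      obtain ⟨q, h1, h2⟩ := exists_rat_btwn (mem_Iio.1 hl)
      exact ⟨q, h2, hls ⟨h1, h2.le⟩⟩
    obtain ⟨d, hdD, hdV⟩ : ∃ d, d ∈ D ∧ h⁻¹ * d ∈ V := by
      have : Continuous fun d => h⁻¹ * d := by fun_prop
      exact hDd.inter_nhds_nonempty (x := h)
        (this.continuousAt.preimage_mem_nhds (by simpa using hV))
    refine ⟨_, hgen (⟨q, hq.trans_le hs⟩, ⟨d, hdD⟩), ?_⟩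
    refine mem_nbhd_of_subset (s := Ico (q : ℝ) s) (fun t ht => ?_) (by simpa using hqs)
    change (stepFun s h t)⁻¹ * stepFun q d t ∈ V
    have h1 := mem_of_mem_nhds hV
    rcases lt_or_ge t q with htq | htq
    · by_cases h0 : 0 ≤ t <;> simp [stepFun, h0, htq, htq.trans hq, hdV, h1]
    · have hts : ¬ t < s := fun h => ht ⟨htq, h⟩
      simp [stepFun, hts, not_lt.2 htq, h1]
  | one => exact S.topologicalClosure.one_mem
  | mul f g _ _ hf hg => exact S.topologicalClosure.mul_mem hf hg
  | inv f _ hf => exact S.topologicalClosure.inv_mem hf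

theorem isEmbedding_const : IsEmbedding (const A) := by
  refine ⟨IsTopologicalGroup.isInducing_iff_nhds_one.2 (le_antisymm ?_ ?_), fun a b hab => ?_⟩
  · refine (nhds_one_hasBasis.comap _).ge_iff.2 ?_
    rintro ⟨V, ε⟩ ⟨hV, hε⟩
    have : (Subtype.val : A → H) ⁻¹' V ∈ 𝓝 1 :=
      continuous_subtype_val.continuousAt.preimage_mem_nhds hV
    filter_upwards [this] with a ha
    refine mem_nbhd_of_subset (s := ∅) (fun t _ => ?_) (by simpa using hε)
    rw [const_apply]
    split_ifs
    · exact ha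
    · exact mem_of_mem_nhds hV
  · intro S hS
    rw [nhds_subtype_eq_comap] at hS
    obtain ⟨V, hV, hVS⟩ := hS
    refine (nhds_one_hasBasis.comap _).mem_iff.2 ⟨(V, ENNReal.ofReal (1 - 0)), ⟨hV, by simp⟩, ?_⟩
    refine fun a ha => hVS ?_
    obtain ⟨t, ht, h⟩ := exists_mem_Ico_of_mem_nbhd ha
    rwa [const_apply_of_mem a ht] at h
  · have h0 : (0 : ℝ) ∈ Ico (0 : ℝ) 1 := by simp
    have := congrArg (fun f : StepGroup A => f 0) hab
    simpa [const_apply_of_mem _ h0] using this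

theorem isClosed_range_const [T2Space H] : IsClosed ((const A).range : Set (StepGroup A)) := by
  refine isClosed_of_closure_subset fun f hf => ?_
  rw [mem_closure_iff_nhds_basis (nhds_hasBasis f)] at hf
  have hconst : ∀ s t, s ∈ Ico (0 : ℝ) 1 → t ∈ Ico (0 : ℝ) 1 → f s = f t := by
    intro s t hs ht
    by_contra hne
    obtain ⟨P, Q, hP, hQ, hPQ⟩ := t2_separation_nhds hne
    have near (x : ℝ) (hx : x ∈ Ico (0 : ℝ) 1) : ∃ b, x < b ∧ b ≤ 1 ∧ ∀ y ∈ Ico x b, f y = f x := by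
      obtain ⟨b, hb, hfb⟩ := mem_nhdsGE_iff_exists_Ico_subset.1
        (eventually_eq_of_mem_stepSubgroup f.2 x)
      exact ⟨min b 1, lt_min hb hx.2, min_le_right _ _, fun y hy =>
        hfb ⟨hy.1, hy.2.trans_le (min_le_left _ _)⟩⟩
    obtain ⟨b, hb, hb1, hfb⟩ := near s hs
    obtain ⟨c, hc, hc1, hfc⟩ := near t ht
    have pull (x : ℝ) {R : Set H} (hR : R ∈ 𝓝 (f x)) : (fun y => f x * y) ⁻¹' R ∈ 𝓝 (1 : H) :=
      (continuous_const_mul (f x)).continuousAt.preimage_mem_nhds (by simpa using hR)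
    -- A single constant `a` close to `f` on the intervals after both `s` and `t` would lie in both
    -- `P` and `Q`.
    obtain ⟨_, ⟨a, rfl⟩, ha⟩ := hf
      (((fun y => f s * y) ⁻¹' P) ∩ ((fun y => f t * y) ⁻¹' Q),
        min (ENNReal.ofReal (b - s)) (ENNReal.ofReal (c - t)))
      ⟨inter_mem (pull s hP) (pull t hQ), lt_min (by simpa using hb) (by simpa using hc)⟩
    have key (x d : ℝ) (hx : x ∈ Ico (0 : ℝ) 1) (hd : d ≤ 1) (hfd : ∀ y ∈ Ico x d, f y = f x)
        (hm : f⁻¹ * const A a ∈ nbhd A (((fun y => f s * y) ⁻¹' P) ∩ ((fun y => f t * y) ⁻¹' Q))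
          (ENNReal.ofReal (d - x))) :
        f s * ((f x)⁻¹ * a) ∈ P ∧ f t * ((f x)⁻¹ * a) ∈ Q := by
      obtain ⟨y, hy, h⟩ := exists_mem_Ico_of_mem_nbhd hm
      rw [mul_apply, inv_apply, hfd y hy,
        const_apply_of_mem a ⟨hx.1.trans hy.1, hy.2.trans_le hd⟩] at h
      exact h
    have h1 := (key s b hs hb1 hfb (nbhd_mono (min_le_left _ _) ha)).1
    have h2 := (key t c ht hc1 hfc (nbhd_mono (min_le_right _ _) ha)).2
    rw [mul_inv_cancel_left] at h1 h2
    exact disjoint_left.1 hPQ h1 h2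
  -- The common value is attained near 1, where it must belong to `A`.
  obtain ⟨x, hxA, hx⟩ := ((eventually_mem_of_mem_stepSubgroup f.2).and
    (Ico_mem_nhdsLT (zero_lt_one' ℝ))).exists
  refine ⟨⟨f x, hxA⟩, ext fun t => ?_⟩
  rw [const_apply]
  split_ifs with ht
  · exact hconst x t hx ht
  · exact (eq_one_of_mem_stepSubgroup f.2 ht).symm

end StepGroup

end Step

theorem mainTheorem7 (G : Type u) [Group G] [TopologicalSpace G] [IsTopologicalGroup G]
    [T2Space G] (hG : IsOmegaNarrow G) :
    List.TFAE [
      -- `G` is homeomorphic to a subspace of a separable regular (Hausdorff) space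
      ∃ (X : Type u) (_ : TopologicalSpace X), T3Space X ∧ TopologicalSpace.SeparableSpace X ∧
        ∃ S : Set X, Nonempty (G ≃ₜ S),
      -- `G` is topologically isomorphic to a subgroup of a separable topological group
      ∃ (H : Type u) (_ : Group H) (_ : TopologicalSpace H),
        IsTopologicalGroup H ∧ T2Space H ∧ TopologicalSpace.SeparableSpace H ∧
        ∃ K : Subgroup H, Nonempty (G ≃ₜ* K),
      -- `G` is topologically isomorphic to a closed subgroup of a separable path-connected,
      -- locally path-connected topological group
      ∃ (H : Type u) (_ : Group H) (_ : TopologicalSpace H),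
        IsTopologicalGroup H ∧ T2Space H ∧ TopologicalSpace.SeparableSpace H ∧
        PathConnectedSpace H ∧ LocallyPathConnectedSpace H ∧
        ∃ K : Subgroup H, IsClosed (K : Set H) ∧ Nonempty (G ≃ₜ* K)] := by
  tfae_have 1 → 2 := by
    rintro ⟨X, _, _, _, S, ⟨e⟩⟩
    obtain ⟨H, _, _, h1, h2, h3, φ, hφ⟩ := hG.exists_embedding_separable
      (IsInducing.subtypeVal.comp e.isInducing)
    exact ⟨H, _, _, h1, h2, h3, φ.range, nonempty_continuousMulEquiv_range φ hφ⟩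
  tfae_have 2 → 3 := by
    rintro ⟨H, _, _, _, _, _, A, ⟨e⟩⟩
    obtain ⟨e'⟩ := nonempty_continuousMulEquiv_range _ (StepGroup.isEmbedding_const (A := A))
    exact ⟨StepGroup A, inferInstance, inferInstance, inferInstance, inferInstance, inferInstance,
      inferInstance, inferInstance, _, StepGroup.isClosed_range_const, ⟨e.trans e'⟩⟩
  tfae_have 3 → 1 := by
    rintro ⟨H, _, _, _, _, h, _, _, K, _, ⟨e⟩⟩
    exact ⟨H, _, inferInstance, h, K, ⟨e.toHomeomorph⟩⟩
  tfae_finish
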